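/- Let $X$ be a connected (Hausdorff, second countable, finite-dimensional) complex manifold, $\Delta\subset\mathbb{C}$ the open unit disk, and $X^*=X\cup\{\infty\}$ the one-point compactification of $X$; for complex manifolds $Y,X$ let $\mathrm{Hol}(Y,X)\subset C^0(Y,X)$ be the space of holomorphic maps with the compact-open topology. Let $$k_\Delta(\zeta,\eta)=\tfrac12\log\frac{1+\left|\frac{\zeta-\eta}{1-\overline{\zeta}\eta}\right|}{1-\left|\frac{\zeta-\eta}{1-\overline{\zeta}\eta}\right|}$$ be the Poincaré distance, let $\delta_X(z,w)=\inf\{k_\Delta(\zeta,\eta)\mid \varphi\in\mathrm{Hol}(\Delta,X),\ \varphi(\zeta)=z,\ \varphi(\eta)=w\}\in[0,+\infty]$, and let $$k_X(z,w)=\inf\Bigl\{\sum_{j=1}^m\delta_X(z_{j-1},z_j)\Bigm| m\ge 1,\ z_0=z,\ z_m=w,\ z_1,\dots,z_{m-1}\in X\Bigr\}$$ be the Kobayashi pseudodistance. Suppose that $X$ is taut, that is, $X$ is hyperbolic ($k_X(z,w)>0$ whenever $z\neq w$) and every map in the closure of $\mathrm{Hol}(\Delta,X)$ in $C^0(\Delta,X^*)$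 either belongs to $\mathrm{Hol}(\Delta,X)$ or is the constant map $\infty$. A sequence $\{g_\nu\}\subset C^0(Y,X)$ is called compactly divergent if for all compact sets $H\subseteq Y$ and $K\subseteq X$ there is $\nu_0\in\mathbb{N}$ such that $g_\nu(H)\cap K=\emptyset$ for all $\nu\ge\nu_0$. Let $f\in\mathrm{Hol}(X,X)$, with iterates $f^0=\mathrm{id}_X$ and $f^k=f\circ f^{k-1}$. Then the following assertions are equivalent: (i) the sequence of iterates $\{f^k\}$ is not compactly divergent; (ii) the sequence $\{f^k\}$ does not contain any compactly divergent subsequence; (iii) $\{f^k\mid k\in\mathbb{N}\}$ is relatively compact in $\mathrm{Hol}(X,X)$; (iv) for every $z\in X$ the orbit $\{f^k(z)\mid k\in\mathbb{N}\}$ is relatively compact in $X$; (v) there exists $z_0\in X$ whose orbit $\{f^k(z_0)\mid k\in\mathbb{N}\}$ is relatively compact in $X$. -/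

import Mathlib

open scoped Manifold ContDiff Topology ENNReal
open Filter

section ComplexManifolds

variable (E : Type*) [NormedAddCommGroup E] [NormedSpace ℂ E]
  (E' : Type*) [NormedAddCommGroup E'] [NormedSpace ℂ E']
  (X : Type*) [TopologicalSpace X] [ChartedSpace E X]
  (Y : Type*) [TopologicalSpace Y] [ChartedSpace E' Y]

/-- The space `Hol(X, Y)` of holomorphic maps between complex manifolds `X` (modelled on `E`) and
`Y` (modelled on `E'`), as a subspace of the space `C(X, Y)` of continuous maps with the
compact-open topology. -/
abbrev Hol : Type _ :=
  {g : C(X, Y) // MDifferentiable 𝓘(ℂ, E) 𝓘(ℂ, E') g}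

/-- The open unit disk of `ℂ`, with its structure of open submanifold of `ℂ`. -/
def unitDisk : TopologicalSpace.Opens ℂ := ⟨Metric.ball 0 1, Metric.isOpen_ball⟩

/-- The Poincaré distance on the unit disk. -/
noncomputable def poincareDist (ζ η : unitDisk) : ℝ :=
  1 / 2 * Real.log
    ((1 + ‖((ζ : ℂ) - η) / (1 - (starRingEnd ℂ) (ζ : ℂ) * η)‖) /
      (1 - ‖((ζ : ℂ) - η) / (1 - (starRingEnd ℂ) (ζ : ℂ) * η)‖))

/-- The Lempert function: the infimum of the Poincaré distances `k(ζ, η)` over all holomorphic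
disks in `X` sending `ζ` to `z` and `η` to `w` (it is `∞` if there are none). -/
noncomputable def lempert (z w : X) : ℝ≥0∞ :=
  ⨅ (φ : Hol ℂ E unitDisk X) (ζ : unitDisk) (η : unitDisk) (_ : φ.1 ζ = z) (_ : φ.1 η = w),
    ENNReal.ofReal (poincareDist ζ η)

/-- The Kobayashi pseudodistance: the infimum of `∑ δ(p_j, p_{j+1})`, `δ` the Lempert function,
over all finite chains `p_0 = z, p_1, …, p_{m+1} = w` of points of `X`. -/
noncomputable def kobayashiDist (z w : X) : ℝ≥0∞ :=
  ⨅ (m : ℕ) (p : ℕ → X) (_ : p 0 = z) (_ : p (m + 1) = w),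
    ∑ j ∈ Finset.range (m + 1), lempert E X (p j) (p (j + 1))

/-- `X` (assumed to be a connected complex manifold) is Kobayashi hyperbolic if the Kobayashi
pseudodistance is a distance, that is, if it separates points. -/
def IsKobayashiHyperbolic : Prop :=
  ∀ z w : X, z ≠ w → 0 < kobayashiDist E X z w

/-- The inclusion of `X` into its one-point compactification `X* = X ∪ {∞}`, as a continuous map. -/
def toOnePoint : C(X, OnePoint X) := ⟨fun x => (x : OnePoint X), OnePoint.continuous_coe⟩

/-- The image of `Hol(Δ, X)`, `Δ` the unit disk, in the space `C(Δ, X*)`. -/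
def holDisks : Set C(unitDisk, OnePoint X) :=
  Set.range fun φ : Hol ℂ E unitDisk X => (toOnePoint X).comp φ.1

/-- A complex manifold `X` is taut if it is hyperbolic and every map in the closure of `Hol(Δ, X)`
in `C(Δ, X*)` either belongs to `Hol(Δ, X)` or is the constant map `∞`. -/
def IsTaut : Prop :=
  IsKobayashiHyperbolic E X ∧
    ∀ g ∈ closure (holDisks E X),
      g ∈ holDisks E X ∨ g = ContinuousMap.const unitDisk (OnePoint.infty : OnePoint X)

end ComplexManifolds

/-- A sequence of continuous maps `g ν : Y → X` is compactly divergent if for all compact `H ⊆ Y`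
and `K ⊆ X` one has `g ν (H) ∩ K = ∅` for all large `ν`. -/
def CompactlyDivergent {Y X : Type*} [TopologicalSpace Y] [TopologicalSpace X]
    (g : ℕ → C(Y, X)) : Prop :=
  ∀ (H : Set Y) (K : Set X), IsCompact H → IsCompact K →
    ∃ ν₀ : ℕ, ∀ ν ≥ ν₀, (g ν '' H) ∩ K = ∅

theorem mdifferentiable_iterate {E : Type*} [NormedAddCommGroup E] [NormedSpace ℂ E]
    {X : Type*} [TopologicalSpace X] [ChartedSpace E X] {f : X → X}
    (hf : MDifferentiable 𝓘(ℂ, E) 𝓘(ℂ, E) f) (k : ℕ) :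
    MDifferentiable 𝓘(ℂ, E) 𝓘(ℂ, E) (f^[k]) := by
  induction k with
  | zero => exact mdifferentiable_id
  | succ k ih => exact ih.comp hf

/-- The `k`-th iterate of `f ∈ Hol(X, X)`, as an element of `Hol(X, X)`. -/
def holIterate {E : Type*} [NormedAddCommGroup E] [NormedSpace ℂ E]
    {X : Type*} [TopologicalSpace X] [ChartedSpace E X] (f : Hol E E X X) (k : ℕ) :
    Hol E E X X :=
  ⟨⟨(f.1 : X → X)^[k], f.1.continuous.iterate k⟩, mdifferentiable_iterate f.2 k⟩

/-!
The Kobayashi distance `k` of a hyperbolic manifold induces its topology (Barth's theorem,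
`topology_eq_kobayashi`): `k` is small near the diagonal because coordinate balls contain affine
disks, and conversely a chain of disks leaving a small ball crosses its frontier, where `k` is
bounded below. So `X` is a locally compact extended metric space on which holomorphic self-maps are
nonexpanding and in which holomorphic disks are equicontinuous.

If the iterates of `f` do not diverge compactly, some orbit accumulates at a point `y` of `X`. As `f`
is nonexpanding, `y` is recurrent, and its return times to a compact ball have bounded gaps, by
compactness of the part of the orbit closure that lies in the ball. Hence the orbit of `y` is
covered by finitely many images of the ball
(`LipschitzWith.exists_isCompact_orbit_of_frequently`). This step needs neither tautness nor
connectedness.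

Tautness carries the relative compactness of one orbit to all others. The disks `f^k ∘ φ` form a
relatively compact family in `C(Δ, X*)`, by Arzelà–Ascoli and because the inclusion of `X` in `X*` is
uniformly continuous. If they stay in a compact subset of `X` at one point of `Δ`, no limit is the
constant map `∞`; by tautness all limits take values in `X`, so the disks stay in a compact set at
every point (`exists_isCompact_disks_apply`). Nearby points of `X` lie on a common disk, and `X` is
connected.

When all orbits are relatively compact, so are the iterates in `C(X, X)`, by Arzelà–Ascoli again, and
`Hol(X, X)` is closed there by the Weierstrass theorem (`isClosed_setOf_mdifferentiable`).
-/

/-! ### The Poincaré distance -/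

theorem unitDisk_norm_lt (ζ : unitDisk) : ‖(ζ : ℂ)‖ < 1 := by
  simpa [unitDisk] using ζ.2

theorem mem_unitDisk_iff {z : ℂ} : z ∈ unitDisk ↔ ‖z‖ < 1 := by
  simp [unitDisk, ← SetLike.mem_coe]

theorem normSq_one_sub_conj_mul_sub (a b : ℂ) :
    Complex.normSq (1 - (starRingEnd ℂ) a * b) - Complex.normSq (a - b) =
      (1 - Complex.normSq a) * (1 - Complex.normSq b) := by
  simp [Complex.normSq_apply]
  ring

theorem norm_sub_lt_norm_one_sub_conj_mul {a b : ℂ} (ha : ‖a‖ < 1) (hb : ‖b‖ < 1) :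
    ‖a - b‖ < ‖1 - (starRingEnd ℂ) a * b‖ := by
  have h := normSq_one_sub_conj_mul_sub a b
  simp only [Complex.normSq_eq_norm_sq] at h
  have ha' : 0 < 1 - ‖a‖ ^ 2 := by nlinarith [norm_nonneg a]
  have hb' : 0 < 1 - ‖b‖ ^ 2 := by nlinarith [norm_nonneg b]
  have := mul_pos ha' hb'
  exact lt_of_pow_lt_pow_left₀ 2 (norm_nonneg _) (by linarith)

theorem one_sub_conj_mul_ne_zero {a b : ℂ} (ha : ‖a‖ < 1) (hb : ‖b‖ < 1) :
    1 - (starRingEnd ℂ) a * b ≠ 0 :=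
  norm_pos_iff.1 ((norm_nonneg _).trans_lt (norm_sub_lt_norm_one_sub_conj_mul ha hb))

theorem norm_sub_div_one_sub_conj_mul_lt_one {a b : ℂ} (ha : ‖a‖ < 1) (hb : ‖b‖ < 1) :
    ‖(a - b) / (1 - (starRingEnd ℂ) a * b)‖ < 1 := by
  rw [norm_div, div_lt_one (norm_pos_iff.2 (one_sub_conj_mul_ne_zero ha hb))]
  exact norm_sub_lt_norm_one_sub_conj_mul ha hb

theorem poincareDist_self (ζ : unitDisk) : poincareDist ζ ζ = 0 := by
  simp [poincareDist]

theorem poincareDist_comm (ζ η : unitDisk) : poincareDist ζ η = poincareDist η ζ := by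
  have h : ‖((ζ : ℂ) - η) / (1 - (starRingEnd ℂ) (ζ : ℂ) * η)‖ =
      ‖((η : ℂ) - ζ) / (1 - (starRingEnd ℂ) (η : ℂ) * ζ)‖ := by
    rw [norm_div, norm_div, norm_sub_rev, ← Complex.norm_conj (1 - (starRingEnd ℂ) (ζ : ℂ) * η)]
    simp [mul_comm]
  simp only [poincareDist, h]

theorem continuous_poincareDist_right (ζ : unitDisk) : Continuous (poincareDist ζ) := by
  have hlt (η : unitDisk) := norm_sub_div_one_sub_conj_mul_lt_one (unitDisk_norm_lt ζ)
    (unitDisk_norm_lt η)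
  have hc : Continuous fun η : unitDisk ↦
      ‖((ζ : ℂ) - η) / (1 - (starRingEnd ℂ) (ζ : ℂ) * η)‖ := by
    refine (Continuous.div (by fun_prop) (by fun_prop) fun η ↦ ?_).norm
    exact one_sub_conj_mul_ne_zero (unitDisk_norm_lt ζ) (unitDisk_norm_lt η)
  unfold poincareDist
  refine continuous_const.mul (Continuous.log ?_ fun η ↦ ?_)
  · refine (continuous_const.add hc).div (continuous_const.sub hc) fun η ↦ ?_
    linarith [hlt η]
  · have h1 := hlt η
    have h2 := norm_nonneg (((ζ : ℂ) - η) / (1 - (starRingEnd ℂ) (ζ : ℂ) * η))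
    exact (div_pos (by linarith) (by linarith)).ne'

theorem poincareDist_le_of_norm_le {ζ ξ η : unitDisk}
    (h : ‖((ζ : ℂ) - ξ) / (1 - (starRingEnd ℂ) (ζ : ℂ) * ξ)‖ ≤
      ‖((ζ : ℂ) - η) / (1 - (starRingEnd ℂ) (ζ : ℂ) * η)‖) :
    poincareDist ζ ξ ≤ poincareDist ζ η := by
  have h1 := norm_sub_div_one_sub_conj_mul_lt_one (unitDisk_norm_lt ζ) (unitDisk_norm_lt η)
  have h2 := norm_nonneg (((ζ : ℂ) - ξ) / (1 - (starRingEnd ℂ) (ζ : ℂ) * ξ))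
  unfold poincareDist
  refine mul_le_mul_of_nonneg_left (Real.log_le_log (div_pos ?_ ?_) ?_) (by norm_num)
  · linarith
  · linarith
  · gcongr

/-- The geodesic segment from `ζ` to `η`: along it the Poincaré distance from `ζ` does not exceed
its value at the far end. -/
theorem exists_path_poincareDist_le (ζ η : unitDisk) :
    ∃ γ : C(unitInterval, unitDisk), γ 0 = ζ ∧ γ 1 = η ∧
      ∀ t, poincareDist ζ (γ t) ≤ poincareDist ζ η := by
  have hζ := unitDisk_norm_lt ζ
  have hη := unitDisk_norm_lt η
  -- the automorphism of the disk exchanging `ζ` and `0` takes `η` to `a`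
  set a : ℂ := ((ζ : ℂ) - η) / (1 - (starRingEnd ℂ) (ζ : ℂ) * η)
  have ha1 : ‖a‖ < 1 := norm_sub_div_one_sub_conj_mul_lt_one hζ hη
  have hta (t : unitInterval) : ‖((t : ℝ) : ℂ) * a‖ ≤ ‖a‖ := by
    rw [norm_mul, Complex.norm_real, Real.norm_of_nonneg t.2.1]
    exact mul_le_of_le_one_left (norm_nonneg _) t.2.2
  have hta1 (t : unitInterval) := (hta t).trans_lt ha1
  have hne (t : unitInterval) : 1 - (starRingEnd ℂ) (ζ : ℂ) * (((t : ℝ) : ℂ) * a) ≠ 0 :=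
    one_sub_conj_mul_ne_zero hζ (hta1 t)
  have hne' := one_sub_conj_mul_ne_zero hζ hη
  have hs : 1 - (starRingEnd ℂ) (ζ : ℂ) * ζ ≠ 0 := one_sub_conj_mul_ne_zero hζ hζ
  -- the same automorphism, an involution, carries the segment `[0, a]` back
  have key (b : ℂ) (hb : 1 - (starRingEnd ℂ) (ζ : ℂ) * b ≠ 0) :
      ((ζ : ℂ) - ((ζ : ℂ) - b) / (1 - (starRingEnd ℂ) (ζ : ℂ) * b)) /
        (1 - (starRingEnd ℂ) (ζ : ℂ) * (((ζ : ℂ) - b) / (1 - (starRingEnd ℂ) (ζ : ℂ) * b))) = b := by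
    have e1 : (ζ : ℂ) - ((ζ : ℂ) - b) / (1 - (starRingEnd ℂ) (ζ : ℂ) * b) =
        b * (1 - (starRingEnd ℂ) (ζ : ℂ) * ζ) / (1 - (starRingEnd ℂ) (ζ : ℂ) * b) := by
      rw [eq_div_iff hb, sub_mul, div_mul_cancel₀ _ hb]
      ring
    have e2 : 1 - (starRingEnd ℂ) (ζ : ℂ) * (((ζ : ℂ) - b) / (1 - (starRingEnd ℂ) (ζ : ℂ) * b)) =
        (1 - (starRingEnd ℂ) (ζ : ℂ) * ζ) / (1 - (starRingEnd ℂ) (ζ : ℂ) * b) := by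
      rw [eq_div_iff hb, sub_mul, mul_assoc _ (_ / _) _, div_mul_cancel₀ _ hb]
      ring
    rw [e1, e2, div_div_div_cancel_right₀ hb, mul_div_cancel_right₀ _ hs]
  refine ⟨⟨fun t ↦ ⟨((ζ : ℂ) - ((t : ℝ) : ℂ) * a) /
    (1 - (starRingEnd ℂ) (ζ : ℂ) * (((t : ℝ) : ℂ) * a)),
    mem_unitDisk_iff.2 (norm_sub_div_one_sub_conj_mul_lt_one hζ (hta1 t))⟩, ?_⟩, ?_, ?_, fun t ↦ ?_⟩
  · refine Continuous.subtype_mk (Continuous.div (by fun_prop) (by fun_prop) hne) _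
  · ext; simp
  · ext
    simpa using key η hne'
  · apply poincareDist_le_of_norm_le
    simp only [ContinuousMap.coe_mk]
    rw [key _ (hne t)]
    exact hta t

/-! ### The Kobayashi pseudodistance -/

section Kobayashi

variable {E : Type*} [NormedAddCommGroup E] [NormedSpace ℂ E]
  {X : Type*} [TopologicalSpace X] [ChartedSpace E X]

theorem lempert_le (φ : Hol ℂ E unitDisk X) (ζ η : unitDisk) :
    lempert E X (φ.1 ζ) (φ.1 η) ≤ ENNReal.ofReal (poincareDist ζ η) :=
  iInf_le_of_le φ <| iInf_le_of_le ζ <| iInf_le_of_le η <| iInf_le_of_le rfl <|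
    iInf_le_of_le rfl le_rfl

theorem le_lempert {z w : X} {c : ℝ≥0∞}
    (h : ∀ (φ : Hol ℂ E unitDisk X) (ζ η : unitDisk), φ.1 ζ = z → φ.1 η = w →
      c ≤ ENNReal.ofReal (poincareDist ζ η)) : c ≤ lempert E X z w :=
  le_iInf fun φ ↦ le_iInf fun ζ ↦ le_iInf fun η ↦ le_iInf fun h1 ↦ le_iInf fun h2 ↦ h φ ζ η h1 h2

theorem lempert_comm (z w : X) : lempert E X z w = lempert E X w z := by
  refine le_antisymm ?_ ?_ <;>
  · refine le_lempert fun φ ζ η h1 h2 ↦ ?_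
    rw [poincareDist_comm, ← h1, ← h2]
    exact lempert_le φ η ζ

theorem lempert_self (z : X) : lempert E X z z = 0 := by
  have h := lempert_le (E := E) (X := X) ⟨ContinuousMap.const unitDisk z, mdifferentiable_const⟩
    ⟨0, by simp [mem_unitDisk_iff]⟩ ⟨0, by simp [mem_unitDisk_iff]⟩
  simpa [poincareDist_self] using h

theorem kobayashiDist_le_sum (m : ℕ) (p : ℕ → X) :
    kobayashiDist E X (p 0) (p (m + 1)) ≤
      ∑ j ∈ Finset.range (m + 1), lempert E X (p j) (p (j + 1)) :=
  iInf_le_of_le m <| iInf_le_of_le p <| iInf_le_of_le rfl <| iInf_le_of_le rfl le_rfl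

theorem le_kobayashiDist {z w : X} {c : ℝ≥0∞}
    (h : ∀ (m : ℕ) (p : ℕ → X), p 0 = z → p (m + 1) = w →
      c ≤ ∑ j ∈ Finset.range (m + 1), lempert E X (p j) (p (j + 1))) :
    c ≤ kobayashiDist E X z w :=
  le_iInf fun m ↦ le_iInf fun p ↦ le_iInf fun h1 ↦ le_iInf fun h2 ↦ h m p h1 h2

theorem kobayashiDist_le_lempert (z w : X) : kobayashiDist E X z w ≤ lempert E X z w := by
  simpa using kobayashiDist_le_sum (E := E) 0 (fun j ↦ if j = 0 then z else w)

theorem kobayashiDist_self (z : X) : kobayashiDist E X z z = 0 :=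
  le_antisymm ((kobayashiDist_le_lempert z z).trans (lempert_self z).le) bot_le

theorem kobayashiDist_comm (z w : X) : kobayashiDist E X z w = kobayashiDist E X w z := by
  have key (z w : X) : kobayashiDist E X z w ≤ kobayashiDist E X w z := by
    refine le_kobayashiDist fun m p h0 hm ↦ ?_
    have h := kobayashiDist_le_sum (E := E) m (fun j ↦ p (m + 1 - j))
    simp only [Nat.sub_zero, hm, Nat.sub_self, h0] at h
    refine h.trans_eq ?_
    rw [← Finset.sum_range_reflect]
    refine Finset.sum_congr rfl fun j hj ↦ ?_
    have hj' : j < m + 1 := Finset.mem_range.1 hj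
    rw [lempert_comm]
    congr 2 <;> omega
  exact le_antisymm (key z w) (key w z)

theorem kobayashiDist_triangle (x y z : X) :
    kobayashiDist E X x z ≤ kobayashiDist E X x y + kobayashiDist E X y z := by
  rw [← tsub_le_iff_right]
  refine le_kobayashiDist fun m p h0 hm ↦ ?_
  rw [tsub_le_iff_right, ← tsub_le_iff_left]
  refine le_kobayashiDist fun n q hq0 hqn ↦ ?_
  rw [tsub_le_iff_left]
  have h := kobayashiDist_le_sum (E := E) (m + 1 + n)
    (fun j ↦ if j ≤ m then p j else q (j - (m + 1)))
  have e : m + 1 + n + 1 - (m + 1) = n + 1 := by omega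
  have e' : ¬ m + 1 + n + 1 ≤ m := by omega
  simp only [Nat.zero_le, if_true, e', if_false, e, h0, hqn] at h
  refine h.trans_eq ?_
  rw [add_assoc (m + 1), Finset.sum_range_add]
  congr 1
  · refine Finset.sum_congr rfl fun j hj ↦ ?_
    have hj' : j < m + 1 := Finset.mem_range.1 hj
    rw [if_pos (by omega)]
    split_ifs with h1
    · rfl
    · have : j = m := by omega
      subst this
      simp [hq0, hm]
  · refine Finset.sum_congr rfl fun j hj ↦ ?_
    rw [if_neg (by omega), if_neg (by omega)]
    congr 2 <;> omega

/-- Holomorphic disks do not increase distances. -/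
theorem kobayashiDist_disk_le (φ : Hol ℂ E unitDisk X) (ζ η : unitDisk) :
    kobayashiDist E X (φ.1 ζ) (φ.1 η) ≤ ENNReal.ofReal (poincareDist ζ η) :=
  (kobayashiDist_le_lempert _ _).trans (lempert_le φ ζ η)

/-- The composition `f ∘ g` of holomorphic maps. -/
def Hol.comp {E₁ E₂ E₃ : Type*} [NormedAddCommGroup E₁] [NormedSpace ℂ E₁]
    [NormedAddCommGroup E₂] [NormedSpace ℂ E₂] [NormedAddCommGroup E₃] [NormedSpace ℂ E₃]
    {X₁ X₂ X₃ : Type*} [TopologicalSpace X₁] [ChartedSpace E₁ X₁] [TopologicalSpace X₂]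
    [ChartedSpace E₂ X₂] [TopologicalSpace X₃] [ChartedSpace E₃ X₃]
    (f : Hol E₂ E₃ X₂ X₃) (g : Hol E₁ E₂ X₁ X₂) : Hol E₁ E₃ X₁ X₃ :=
  ⟨f.1.comp g.1, f.2.comp g.2⟩

theorem lempert_map_le (f : Hol E E X X) (z w : X) :
    lempert E X (f.1 z) (f.1 w) ≤ lempert E X z w := by
  refine le_lempert fun φ ζ η h1 h2 ↦ ?_
  rw [← h1, ← h2]
  exact lempert_le (f.comp φ) ζ η

theorem kobayashiDist_map_le (f : Hol E E X X) (z w : X) :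
    kobayashiDist E X (f.1 z) (f.1 w) ≤ kobayashiDist E X z w := by
  refine le_kobayashiDist fun m p h0 hm ↦ ?_
  rw [← h0, ← hm]
  exact (kobayashiDist_le_sum (E := E) m (fun j ↦ f.1 (p j))).trans
    (Finset.sum_le_sum fun j _ ↦ lempert_map_le f _ _)

/-- Every point `z` has a neighbourhood each point of which lies, together with `z`, on a
holomorphic disk; the parameter of the point on the disk tends to the centre as the point tends
to `z`. -/
theorem exists_disk_near [IsManifold 𝓘(ℂ, E) ω X] (z : X) :
    ∃ c : X → ℝ, Tendsto c (𝓝 z) (𝓝 0) ∧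
      ∀ᶠ w in 𝓝 z, ∃ (φ : Hol ℂ E unitDisk X) (ζ η : unitDisk),
        φ.1 ζ = z ∧ φ.1 η = w ∧ poincareDist ζ η = c w := by
  let e := chartAt E z
  have hmem : e.target ∈ 𝓝 (e z) := e.open_target.mem_nhds (e.map_source (mem_chart_source E z))
  obtain ⟨r, hr, hball⟩ := Metric.mem_nhds_iff.1 hmem
  let o : unitDisk := ⟨0, by simp [mem_unitDisk_iff]⟩
  -- the disk through `z` and `w` is the affine disk of radius `r` centred at `e z`; `w` sits at
  -- the parameter `‖e w - e z‖ / r`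
  let c : X → ℝ := fun w ↦ 1 / 2 * Real.log ((1 + ‖e w - e z‖ / r) / (1 - ‖e w - e z‖ / r))
  have hcont : ContinuousAt e z := e.continuousAt (mem_chart_source E z)
  refine ⟨c, ?_, ?_⟩
  · have h1 : Tendsto (fun w ↦ ‖e w - e z‖ / r) (𝓝 z) (𝓝 0) := by
      have : Tendsto (fun w ↦ ‖e w - e z‖ / r) (𝓝 z) (𝓝 (‖e z - e z‖ / r)) :=
        ((hcont.tendsto.sub_const _).norm).div_const _
      simpa using this
    have h2 : ContinuousAt (fun s : ℝ ↦ 1 / 2 * Real.log ((1 + s) / (1 - s))) 0 := by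
      refine continuousAt_const.mul (ContinuousAt.log ?_ (by norm_num))
      exact (by fun_prop : ContinuousAt (fun s : ℝ ↦ 1 + s) 0).div (by fun_prop) (by norm_num)
    simpa [c, Function.comp_def] using h2.tendsto.comp h1
  · have hnear : ∀ᶠ w in 𝓝 z, e w ∈ Metric.ball (e z) r :=
      hcont.eventually (Metric.ball_mem_nhds _ hr)
    filter_upwards [hnear, e.open_source.mem_nhds (mem_chart_source E z)] with w hw hws
    obtain ⟨v, hv1, hv2⟩ : ∃ v : E, ‖v‖ ≤ r ∧ ((‖e w - e z‖ / r : ℝ) : ℂ) • v = e w - e z := by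
      by_cases h0 : e w - e z = 0
      · exact ⟨0, by simpa using hr.le, by simp [h0]⟩
      · have hn : (‖e w - e z‖ : ℂ) ≠ 0 := by simpa using h0
        have hrC : (r : ℂ) ≠ 0 := by exact_mod_cast hr.ne'
        refine ⟨((r / ‖e w - e z‖ : ℝ) : ℂ) • (e w - e z), ?_, ?_⟩
        · rw [norm_smul, Complex.norm_real, Real.norm_of_nonneg (by positivity),
            div_mul_cancel₀ _ (by simpa using h0)]
        · rw [smul_smul]
          push_cast
          rw [div_mul_div_cancel₀ hrC, div_self hn, one_smul]
    have hmaps (ζ : unitDisk) : e z + (ζ : ℂ) • v ∈ e.target := by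
      refine hball ?_
      rw [mem_ball_iff_norm, add_sub_cancel_left, norm_smul]
      calc ‖(ζ : ℂ)‖ * ‖v‖ ≤ ‖(ζ : ℂ)‖ * r := by gcongr
        _ < 1 * r := by gcongr; exact unitDisk_norm_lt ζ
        _ = r := one_mul r
    have haff : MDifferentiable 𝓘(ℂ, ℂ) 𝓘(ℂ, E) fun ζ : unitDisk ↦ e z + (ζ : ℂ) • v := by
      have h1 : MDifferentiable 𝓘(ℂ, ℂ) 𝓘(ℂ, E) fun s : ℂ ↦ e z + s • v :=
        Differentiable.mdifferentiable (by fun_prop)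
      exact h1.comp ((contMDiff_subtype_val (n := 1)).mdifferentiable (by simp))
    have hφ : MDifferentiable 𝓘(ℂ, ℂ) 𝓘(ℂ, E) fun ζ : unitDisk ↦ e.symm (e z + (ζ : ℂ) • v) := by
      intro ζ
      have : IsManifold 𝓘(ℂ, E) 1 X := IsManifold.of_le (n := ω) (by simp)
      exact (mdifferentiableAt_atlas_symm (chart_mem_atlas E z) (hmaps ζ)).comp ζ (haff ζ)
    have hs0 : 0 ≤ ‖e w - e z‖ / r := by positivity
    have hs1 : ‖e w - e z‖ / r < 1 := by
      rw [div_lt_one hr]; exact mem_ball_iff_norm.1 hw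
    refine ⟨⟨⟨_, hφ.continuous⟩, hφ⟩, o, ⟨((‖e w - e z‖ / r : ℝ) : ℂ), ?_⟩, ?_, ?_, ?_⟩
    · rw [mem_unitDisk_iff, Complex.norm_real, Real.norm_of_nonneg hs0]
      exact hs1
    · simp [o, e]
    · simp only [ContinuousMap.coe_mk, hv2, add_sub_cancel]
      exact e.left_inv hws
    · simp only [poincareDist, o, c, zero_sub, map_zero, zero_mul, sub_zero, div_one, norm_neg,
        Complex.norm_real, Real.norm_of_nonneg hs0]

theorem tendsto_kobayashiDist_nhds [IsManifold 𝓘(ℂ, E) ω X] (z : X) :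
    Tendsto (kobayashiDist E X z) (𝓝 z) (𝓝 0) := by
  obtain ⟨c, hc, h⟩ := exists_disk_near (E := E) z
  have h0 : Tendsto (fun w ↦ ENNReal.ofReal (c w)) (𝓝 z) (𝓝 0) := by
    simpa using ENNReal.tendsto_ofReal hc
  refine tendsto_of_tendsto_of_tendsto_of_le_of_le' tendsto_const_nhds h0
    (Eventually.of_forall fun _ ↦ bot_le) ?_
  filter_upwards [h] with w ⟨φ, ζ, η, h1, h2, h3⟩
  have h := kobayashiDist_disk_le φ ζ η
  rwa [h1, h2, h3] at h

/-- A chain of disks that leaves the set `V` crosses its frontier, so it is at least as long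
as the distance from its starting point to the frontier. -/
theorem le_sum_lempert_of_notMem {V : Set X} {ε : ℝ≥0∞} (p : ℕ → X)
    (h0 : p 0 ∈ V) (hε : ∀ s ∈ frontier V, ε ≤ kobayashiDist E X (p 0) s) (n : ℕ)
    (hn : p n ∉ V) :
    ε ≤ ∑ j ∈ Finset.range n, lempert E X (p j) (p (j + 1)) := by
  induction n with
  | zero => exact absurd h0 hn
  | succ n ih =>
    rw [Finset.sum_range_succ]
    by_cases hpn : p n ∈ V
    · rw [← tsub_le_iff_left]
      refine le_lempert fun φ ζ η h1 h2 ↦ ?_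
      rw [tsub_le_iff_left]
      obtain ⟨γ, hγ0, hγ1, hγ⟩ := exists_path_poincareDist_le ζ η
      have hcont : Continuous fun t ↦ φ.1 (γ t) := by fun_prop
      obtain ⟨t, ht⟩ : (frontier ((fun t ↦ φ.1 (γ t)) ⁻¹' V)).Nonempty := by
        refine nonempty_frontier_iff.2 ⟨⟨0, by simpa [hγ0, h1]⟩, fun h ↦ hn ?_⟩
        simpa [hγ1, h2] using h.ge (Set.mem_univ 1)
      have hs := hcont.frontier_preimage_subset V ht
      have hsum : kobayashiDist E X (p 0) (p n) ≤
          ∑ j ∈ Finset.range n, lempert E X (p j) (p (j + 1)) := by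
        cases n with
        | zero => simp [kobayashiDist_self]
        | succ n => exact kobayashiDist_le_sum n p
      calc ε ≤ kobayashiDist E X (p 0) (φ.1 (γ t)) := hε _ hs
        _ ≤ kobayashiDist E X (p 0) (p n) + kobayashiDist E X (p n) (φ.1 (γ t)) :=
          kobayashiDist_triangle _ _ _
        _ ≤ _ := by
          refine add_le_add hsum ?_
          rw [← h1]
          exact (kobayashiDist_disk_le φ ζ (γ t)).trans (ENNReal.ofReal_le_ofReal (hγ t))
    · exact (ih hpn).trans le_self_add

/-- The Kobayashi distance from a point is bounded below on compact sets that avoid the point. -/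
theorem exists_pos_le_kobayashiDist [IsManifold 𝓘(ℂ, E) ω X] (hX : IsKobayashiHyperbolic E X)
    {z : X} {K : Set X} (hK : IsCompact K) (hz : z ∉ K) :
    ∃ ε > 0, ∀ s ∈ K, ε ≤ kobayashiDist E X z s := by
  have key : ∀ s ∈ K, ∃ t ∈ 𝓝[K] s, ∃ ε > 0, ∀ x ∈ t, ε ≤ kobayashiDist E X z x := by
    intro s hs
    have hpos : 0 < kobayashiDist E X z s := hX z s (by rintro rfl; exact hz hs)
    obtain ⟨ε, hε0, hε⟩ := exists_between hpos
    obtain ⟨δ, hδ0, hδ⟩ : ∃ δ > 0, ε + δ < kobayashiDist E X z s := by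
      obtain ⟨r, hr, hr'⟩ := ENNReal.lt_iff_exists_add_pos_lt.1 hε
      exact ⟨r, by exact_mod_cast hr, hr'⟩
    refine ⟨_, nhdsWithin_le_nhds ((tendsto_kobayashiDist_nhds (E := E) s).eventually_lt_const hδ0),
      ε, hε0, fun x hx ↦ ?_⟩
    by_contra! hlt
    refine lt_irrefl _ (hδ.trans_le ((kobayashiDist_triangle z x s).trans ?_))
    rw [kobayashiDist_comm x s]
    exact add_le_add hlt.le (le_of_lt hx)
  refine hK.induction_on (p := fun t ↦ ∃ ε > 0, ∀ s ∈ t, ε ≤ kobayashiDist E X z s)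
    ⟨1, one_pos, by simp⟩ ?_ ?_ key
  · rintro s t hst ⟨ε, h0, h⟩
    exact ⟨ε, h0, fun x hx ↦ h x (hst hx)⟩
  · rintro s t ⟨ε, h0, h⟩ ⟨δ, h0', h'⟩
    exact ⟨min ε δ, lt_min h0 h0', fun x hx ↦ hx.elim
      (fun hx ↦ (min_le_left _ _).trans (h x hx)) fun hx ↦ (min_le_right _ _).trans (h' x hx)⟩

/-- The small balls of the Kobayashi distance of a hyperbolic manifold form a basis of
neighbourhoods. -/
theorem exists_kobayashiBall_subset [IsManifold 𝓘(ℂ, E) ω X] [LocallyCompactSpace X] [T2Space X]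
    (hX : IsKobayashiHyperbolic E X) {z : X} {U : Set X} (hU : U ∈ 𝓝 z) :
    ∃ ε > 0, ∀ w, kobayashiDist E X z w < ε → w ∈ U := by
  obtain ⟨K, hK, hKU, hKc⟩ := local_compact_nhds hU
  have hzV : z ∈ interior K := mem_interior_iff_mem_nhds.2 hK
  have hfr : IsCompact (frontier (interior K)) :=
    hKc.of_isClosed_subset isClosed_frontier
      (frontier_subset_closure.trans (closure_minimal interior_subset hKc.isClosed))
  have hzf : z ∉ frontier (interior K) := by
    rw [isOpen_interior.frontier_eq]
    exact fun h ↦ h.2 hzV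
  obtain ⟨ε, hε0, hε⟩ := exists_pos_le_kobayashiDist (E := E) hX hfr hzf
  refine ⟨ε, hε0, fun w hw ↦ ?_⟩
  by_contra hwU
  refine hw.not_ge (le_kobayashiDist fun m p h0 hm ↦ ?_)
  refine le_sum_lempert_of_notMem (V := interior K) p (by rwa [h0]) (by rwa [h0]) _ ?_
  rw [hm]
  exact fun h ↦ hwU (hKU (interior_subset h))

/-- The Kobayashi distance of a hyperbolic manifold as an extended metric, before its topology is
identified with that of the manifold. -/
noncomputable abbrev kobayashiEMetricAux (hX : IsKobayashiHyperbolic E X) : EMetricSpace X where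
  edist := kobayashiDist E X
  edist_self := kobayashiDist_self
  edist_comm := kobayashiDist_comm
  edist_triangle := kobayashiDist_triangle
  eq_of_edist_eq_zero {z w} h := by
    by_contra hzw
    exact (hX z w hzw).ne' h

/-- Barth's theorem: the Kobayashi distance of a hyperbolic manifold induces its topology. -/
theorem topology_eq_kobayashi [IsManifold 𝓘(ℂ, E) ω X] [LocallyCompactSpace X] [T2Space X]
    (hX : IsKobayashiHyperbolic E X) :
    ‹TopologicalSpace X› = (kobayashiEMetricAux hX).toUniformSpace.toTopologicalSpace := by
  refine TopologicalSpace.ext_nhds fun z ↦ ?_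
  have hb := @Metric.nhds_basis_eball X (kobayashiEMetricAux hX).toPseudoEMetricSpace z
  refine le_antisymm (hb.ge_iff.2 fun ε hε ↦ ?_) fun U hU ↦ hb.mem_iff.2 ?_
  · filter_upwards [(tendsto_kobayashiDist_nhds (E := E) z).eventually_lt_const hε] with w hw
    exact (kobayashiDist_comm w z).trans_lt hw
  · obtain ⟨ε, hε, h⟩ := exists_kobayashiBall_subset hX hU
    exact ⟨ε, hε, fun w hw ↦ h w ((kobayashiDist_comm z w).trans_lt hw)⟩

/-- A hyperbolic manifold with its Kobayashi distance, as an extended metric space. -/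
noncomputable abbrev kobayashiEMetric [IsManifold 𝓘(ℂ, E) ω X] [LocallyCompactSpace X] [T2Space X]
    (hX : IsKobayashiHyperbolic E X) : EMetricSpace X :=
  (kobayashiEMetricAux hX).replaceTopology (topology_eq_kobayashi hX)

end Kobayashi

/-! ### Recurrence for nonexpanding maps -/

section Nonexpanding

variable {X : Type*} [PseudoEMetricSpace X] {f : X → X}

theorem LipschitzWith.edist_iterate_le (hf : LipschitzWith 1 f) (k : ℕ) (x y : X) :
    edist (f^[k] x) (f^[k] y) ≤ edist x y := by
  simpa using hf.iterate k x y

/-- A limit point `y` of an orbit of a nonexpanding map is recurrent: between two late visits of the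
orbit near `y`, the iterates of `y` itself return near `y`. -/
theorem LipschitzWith.exists_edist_iterate_lt_of_tendsto (hf : LipschitzWith 1 f) {n : ℕ → ℕ}
    (hn : StrictMono n) {x y : X} (h : Tendsto (fun i ↦ f^[n i] x) atTop (𝓝 y))
    {ε : ℝ≥0∞} (hε : 0 < ε) (N : ℕ) : ∃ k ≥ N, edist (f^[k] y) y < ε := by
  have hε2 : 0 < ε / 2 := ENNReal.half_pos hε.ne'
  obtain ⟨I, hI⟩ := eventually_atTop.1 ((EMetric.tendsto_nhds.1 h) _ hε2)
  obtain ⟨J, hJI, hJ⟩ := ((eventually_ge_atTop I).and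
    (hn.tendsto_atTop.eventually_ge_atTop (n I + N))).exists
  refine ⟨n J - n I, by omega, ?_⟩
  have e : f^[n J - n I] (f^[n I] x) = f^[n J] x := by
    rw [← Function.iterate_add_apply]
    congr 2
    omega
  calc edist (f^[n J - n I] y) y
      ≤ edist (f^[n J - n I] y) (f^[n J] x) + edist (f^[n J] x) y := edist_triangle _ _ _
    _ ≤ edist (f^[n I] x) y + edist (f^[n J] x) y := by
      gcongr
      rw [← e, edist_comm _ y]
      exact hf.edist_iterate_le _ _ _
    _ < ε / 2 + ε / 2 := ENNReal.add_lt_add (hI I le_rfl) (hI J hJI)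
    _ = ε := ENNReal.add_halves ε

/-- In a locally compact space, a recurrent point of a nonexpanding map has a relatively compact
orbit. The point is that the return times to a compact ball `B` around it have bounded gaps: each
point of `B` in the orbit closure comes back, and by compactness finitely many return times
suffice. -/
theorem LipschitzWith.exists_isCompact_orbit_of_recurrent [LocallyCompactSpace X]
    (hf : LipschitzWith 1 f) {y : X}
    (hy : ∀ ε > 0, ∀ N, ∃ k ≥ N, edist (f^[k] y) y < ε) :
    ∃ C, IsCompact C ∧ ∀ k, f^[k] y ∈ C := by
  obtain ⟨B, hB, hBy⟩ := exists_compact_mem_nhds y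
  obtain ⟨r, hr, hrB⟩ := EMetric.mem_nhds_iff.1 hBy
  have hr2 : 0 < r / 2 := ENNReal.half_pos hr.ne'
  set S := B ∩ closure (Set.range fun k ↦ f^[k] y)
  have hSc : IsCompact S := hB.inter_right isClosed_closure
  have hopen (m : ℕ) : IsOpen {p | edist (f^[m] p) y < r} :=
    isOpen_lt ((hf.continuous.iterate m).edist continuous_const) continuous_const
  have hcover : S ⊆ ⋃ m : ℕ, {p | edist (f^[m + 1] p) y < r} := by
    rintro p ⟨-, hp⟩
    obtain ⟨_, ⟨j, rfl⟩, hj⟩ := EMetric.mem_closure_iff.1 hp _ hr2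
    obtain ⟨k, hk, hky⟩ := hy _ hr2 (j + 1)
    refine Set.mem_iUnion.2 ⟨k - j - 1, ?_⟩
    have e : f^[k - j - 1 + 1] (f^[j] y) = f^[k] y := by
      rw [← Function.iterate_add_apply]
      congr 2
      omega
    calc edist (f^[k - j - 1 + 1] p) y
        ≤ edist (f^[k - j - 1 + 1] p) (f^[k] y) + edist (f^[k] y) y := edist_triangle _ _ _
      _ ≤ edist p (f^[j] y) + edist (f^[k] y) y := by
        gcongr
        rw [← e]
        exact hf.edist_iterate_le _ _ _
      _ < r / 2 + r / 2 := ENNReal.add_lt_add hj hky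
      _ = r := ENNReal.add_halves r
  obtain ⟨t, ht⟩ := hSc.elim_finite_subcover _ (fun m ↦ hopen (m + 1)) hcover
  -- gaps between consecutive visits to `B` are at most `M + 1`
  obtain ⟨M, hM⟩ : ∃ M, ∀ m ∈ t, m ≤ M := ⟨t.sup id, fun m hm ↦ Finset.le_sup (f := id) hm⟩
  have hreturn (i : ℕ) (hi : f^[i] y ∈ B) : ∃ m ≤ M, f^[m + 1 + i] y ∈ B := by
    obtain ⟨m, hm, hmi⟩ := Set.mem_iUnion₂.1 (ht ⟨hi, subset_closure ⟨i, rfl⟩⟩)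
    refine ⟨m, hM m hm, hrB ?_⟩
    rw [Function.iterate_add_apply]
    exact hmi
  have hgap (k : ℕ) : ∃ i j, j ≤ M ∧ j + i = k ∧ f^[i] y ∈ B := by
    induction k with
    | zero => exact ⟨0, 0, Nat.zero_le _, rfl, mem_of_mem_nhds hBy⟩
    | succ k ih =>
      obtain ⟨i, j, hj, hji, hi⟩ := ih
      rcases hj.lt_or_eq with hlt | rfl
      · exact ⟨i, j + 1, hlt, by omega, hi⟩
      · obtain ⟨m, hm, hmi⟩ := hreturn i hi
        exact ⟨m + 1 + i, j - m, by omega, by omega, hmi⟩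
  refine ⟨⋃ j ∈ Finset.range (M + 1), f^[j] '' B,
    (Finset.range (M + 1)).isCompact_biUnion fun j _ ↦ hB.image (hf.continuous.iterate j),
    fun k ↦ ?_⟩
  obtain ⟨i, j, hj, rfl, hi⟩ := hgap k
  refine Set.mem_iUnion₂.2 ⟨j, Finset.mem_range.2 (by omega), f^[i] y, hi, ?_⟩
  rw [Function.iterate_add_apply]

/-- If the iterates of a nonexpanding map do not diverge compactly, some orbit is relatively
compact. -/
theorem LipschitzWith.exists_isCompact_orbit_of_frequently [LocallyCompactSpace X]
    (hf : LipschitzWith 1 f) {H K : Set X} (hH : IsCompact H) (hK : IsCompact K)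
    (h : ∃ᶠ k in atTop, (f^[k] '' H ∩ K).Nonempty) :
    ∃ y C, IsCompact C ∧ ∀ k, f^[k] y ∈ C := by
  obtain ⟨n, hn, hnHK⟩ := extraction_of_frequently_atTop h
  have hx (i : ℕ) : ∃ x ∈ H, f^[n i] x ∈ K := by
    obtain ⟨_, ⟨x, hx, rfl⟩, hxK⟩ := hnHK i
    exact ⟨x, hx, hxK⟩
  choose x hxH hxK using hx
  obtain ⟨a, -, φ, hφ, ha⟩ := hH.tendsto_subseq hxH
  obtain ⟨y, -, ψ, hψ, hy⟩ := hK.tendsto_subseq fun i ↦ hxK (φ i)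
  have ha' := ha.comp hψ.tendsto_atTop
  have hmono := hn.comp (hφ.comp hψ)
  have hlim : Tendsto (fun i ↦ f^[(n ∘ φ ∘ ψ) i] a) atTop (𝓝 y) := by
    refine EMetric.tendsto_nhds.2 fun ε hε ↦ ?_
    have hε2 : 0 < ε / 2 := ENNReal.half_pos hε.ne'
    filter_upwards [EMetric.tendsto_nhds.1 ha' _ hε2, EMetric.tendsto_nhds.1 hy _ hε2] with i h1 h2
    calc edist (f^[(n ∘ φ ∘ ψ) i] a) y
        ≤ edist (f^[(n ∘ φ ∘ ψ) i] a) (f^[(n ∘ φ ∘ ψ) i] (x (φ (ψ i)))) +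
          edist (f^[(n ∘ φ ∘ ψ) i] (x (φ (ψ i)))) y := edist_triangle _ _ _
      _ ≤ edist (x (φ (ψ i))) a + edist (f^[(n ∘ φ ∘ ψ) i] (x (φ (ψ i)))) y := by
        gcongr
        rw [edist_comm _ a]
        exact hf.edist_iterate_le _ _ _
      _ < ε / 2 + ε / 2 := ENNReal.add_lt_add h1 h2
      _ = ε := ENNReal.add_halves ε
  exact ⟨y, hf.exists_isCompact_orbit_of_recurrent fun ε hε N ↦
    hf.exists_edist_iterate_lt_of_tendsto hmono hlim hε N⟩

end Nonexpanding

/-! ### Compactness in spaces of continuous maps -/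

/-- Arzelà–Ascoli for the compact-open topology. -/
theorem ContinuousMap.isCompact_closure_of_equicontinuous {Y Z : Type*} [TopologicalSpace Y]
    [WeaklyLocallyCompactSpace Y] [UniformSpace Z] [T2Space Z] {S : Set C(Y, Z)}
    (hS : Equicontinuous fun g : S ↦ (g : Y → Z))
    (hc : ∀ y, ∃ Q, IsCompact Q ∧ ∀ g ∈ S, g y ∈ Q) : IsCompact (closure S) := by
  refine ArzelaAscoli.isCompact_closure_of_isClosedEmbedding (𝔖 := {K | IsCompact K})
    (F := fun g : C(Y, Z) ↦ (g : Y → Z)) (fun _ hK ↦ hK) ?_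
    (fun K _ ↦ hS.equicontinuousOn K) fun _ _ y _ ↦ hc y
  refine ⟨ContinuousMap.isUniformEmbedding_toUniformOnFunIsCompact.isEmbedding, ?_⟩
  have h := UniformOnFun.isClosed_setOfPred_continuous (α := Y) (β := Z)
    (𝔖 := {K | IsCompact K}) (.of_nhds exists_compact_mem_nhds)
  convert h
  exact ContinuousMap.range_toUniformOnFunIsCompact

/-- The inclusion of a locally compact uniform space into its one-point compactification is
uniformly continuous. -/
theorem OnePoint.tendsto_coe_uniformity {X : Type*} [UniformSpace X] [T2Space X]
    [LocallyCompactSpace X] :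
    Tendsto (fun p : X × X ↦ ((p.1 : OnePoint X), (p.2 : OnePoint X))) (uniformity X)
      (@uniformity (OnePoint X) uniformSpaceOfCompactR1) := by
  let _ : UniformSpace (OnePoint X) := uniformSpaceOfCompactR1
  refine tendsto_iff_ultrafilter _ _ _ |>.2 fun u hu ↦ ?_
  have hlim (g : X × X → OnePoint X) : ∃ a, Tendsto g u (𝓝 a) :=
    ⟨_, (u.map g).le_nhds_lim⟩
  obtain ⟨a, ha⟩ := hlim fun p ↦ (p.1 : OnePoint X)
  obtain ⟨b, hb⟩ := hlim fun p ↦ (p.2 : OnePoint X)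
  -- if one of the two limits is a point of `X`, the other one is the same point
  have h1 (x : X) (hx : a = x) : a = b := by
    subst hx
    have hx : Tendsto (fun p : X × X ↦ p.1) u (𝓝 x) :=
      OnePoint.isOpenEmbedding_coe.isInducing.tendsto_nhds_iff.2 ha
    have hx' : Tendsto (fun p : X × X ↦ p.2) u (𝓝 x) := hx.congr_uniformity hu
    exact tendsto_nhds_unique ((OnePoint.continuous_coe.tendsto x).comp hx') hb
  have h2 (x : X) (hx : b = x) : a = b := by
    subst hx
    have hx : Tendsto (fun p : X × X ↦ p.2) u (𝓝 x) :=
      OnePoint.isOpenEmbedding_coe.isInducing.tendsto_nhds_iff.2 hb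
    have hx' : Tendsto (fun p : X × X ↦ p.1) u (𝓝 x) :=
      hx.congr_uniformity (tendsto_swap_uniformity.comp hu)
    exact (tendsto_nhds_unique ((OnePoint.continuous_coe.tendsto x).comp hx') ha).symm
  have hab : a = b := by
    induction a using OnePoint.rec with
    | coe x => exact h1 x rfl
    | infty =>
      induction b using OnePoint.rec with
      | coe x => exact h2 x rfl
      | infty => rfl
  subst hab
  exact (ha.prodMk_nhds hb).mono_right (nhds_le_uniformity a)

/-- An equicontinuous family of maps into `X` is relatively compact in the space of continuous maps
into the one-point compactification of `X`. -/
theorem isCompact_closure_range_toOnePoint_comp {Y X ι : Type*} [TopologicalSpace Y]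
    [WeaklyLocallyCompactSpace Y] [UniformSpace X] [T2Space X] [LocallyCompactSpace X]
    {ψ : ι → C(Y, X)} (hψ : Equicontinuous fun i ↦ (ψ i : Y → X)) :
    IsCompact (closure (Set.range fun i ↦ (toOnePoint X).comp (ψ i))) := by
  let _ : UniformSpace (OnePoint X) := uniformSpaceOfCompactR1
  refine ContinuousMap.isCompact_closure_of_equicontinuous (fun y U hU ↦ ?_)
    fun y ↦ ⟨Set.univ, isCompact_univ, fun _ _ ↦ Set.mem_univ _⟩
  filter_upwards [hψ y _ (OnePoint.tendsto_coe_uniformity hU)] with y' hy'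
  rintro ⟨_, i, rfl⟩
  exact hy' i

/-! ### Limits of holomorphic maps -/

/-- **Weierstrass theorem** on normed spaces: a uniform limit of holomorphic maps on a ball is
differentiable at the centre. By the Schwarz lemma the derivatives form a uniform Cauchy sequence
on the ball of half the radius. -/
theorem differentiableAt_of_tendstoUniformlyOn_ball {E F ι : Type*} [NormedAddCommGroup E]
    [NormedSpace ℂ E] [NormedAddCommGroup F] [NormedSpace ℂ F] [CompleteSpace F]
    {l : Filter ι} [l.NeBot] {G : ι → E → F} {g : E → F} {c : E} {r : ℝ} (hr : 0 < r)
    (hG : ∀ᶠ n in l, DifferentiableOn ℂ (G n) (Metric.ball c r))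
    (h : TendstoUniformlyOn G g l (Metric.ball c r)) : DifferentiableAt ℂ g c := by
  have hr2 : 0 < r / 2 := half_pos hr
  have hsub {x : E} (hx : x ∈ Metric.ball c (r / 2)) :
      Metric.ball x (r / 2) ⊆ Metric.ball c r := by
    refine Metric.ball_subset_ball' ?_
    linarith [Metric.mem_ball.1 hx]
  have hcauchy : UniformCauchySeqOn (fun n ↦ fderiv ℂ (G n)) l (Metric.ball c (r / 2)) := by
    intro u hu
    obtain ⟨ε, hε, hεu⟩ := Metric.mem_uniformity_dist.1 hu
    -- `G n - G m` then varies by at most `ε * r / 4` on balls of radius `r / 2`, so the Schwarz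
    -- lemma bounds its derivative by `ε / 2`
    have hδ : 0 < ε * r / 16 := by positivity
    have hn := hG.and (Metric.tendstoUniformlyOn_iff.1 h _ hδ)
    filter_upwards [prod_mem_prod hn hn] with ⟨n, m⟩ ⟨⟨hn1, hn2⟩, ⟨hm1, hm2⟩⟩ x hx
    refine hεu ?_
    have hdiff {k : ι} (hk : DifferentiableOn ℂ (G k) (Metric.ball c r)) :
        DifferentiableAt ℂ (G k) x :=
      (hk x (hsub hx (Metric.mem_ball_self hr2))).differentiableAt
        (Metric.isOpen_ball.mem_nhds (hsub hx (Metric.mem_ball_self hr2)))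
    have hclose (y : E) (hy : y ∈ Metric.ball c r) : ‖G n y - G m y‖ ≤ ε * r / 8 := by
      rw [← dist_eq_norm]
      have := dist_triangle_left (G n y) (G m y) (g y)
      linarith [hn2 y hy, hm2 y hy]
    have hmaps : Set.MapsTo (G n - G m) (Metric.ball x (r / 2))
        (Metric.closedBall ((G n - G m) x) (ε * r / 4)) := by
      intro y hy
      rw [Metric.mem_closedBall, dist_eq_norm]
      have h1 := hclose y (hsub hx hy)
      have h2 := hclose x (hsub hx (Metric.mem_ball_self hr2))
      exact (norm_sub_le _ _).trans (by simp only [Pi.sub_apply]; linarith)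
    have hbound := Complex.norm_fderiv_le_div_of_mapsTo_ball
      ((hn1.sub hm1).mono (hsub hx)) hmaps hr2
    rw [fderiv_sub (hdiff hn1) (hdiff hm1)] at hbound
    rw [dist_eq_norm]
    refine hbound.trans_lt ?_
    rw [div_lt_iff₀ hr2]
    nlinarith [mul_pos hε hr]
  have hex (x : E) (hx : x ∈ Metric.ball c (r / 2)) :
      ∃ L, Tendsto (fun n ↦ fderiv ℂ (G n) x) l (𝓝 L) :=
    cauchy_map_iff_exists_tendsto.1 (hcauchy.cauchy_map hx)
  choose! g' hg' using hex
  have hunif := hcauchy.tendstoUniformlyOn_of_tendsto hg'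
  have hmem : Metric.ball c (r / 2) ∈ 𝓝 c := Metric.ball_mem_nhds c hr2
  refine (hasFDerivAt_of_tendstoUniformlyOnFilter (𝕜 := ℂ) (f := G) (g' := g')
    (f' := fun n ↦ fderiv ℂ (G n)) (hunif.tendstoUniformlyOnFilter.mono_right
      (le_principal_iff.2 hmem)) ?_ ?_).differentiableAt
  · filter_upwards [prod_mem_prod hG hmem] with p hp
    exact ((hp.1 _ (hsub hp.2 (Metric.mem_ball_self hr2))).differentiableAt
      (Metric.isOpen_ball.mem_nhds (hsub hp.2 (Metric.mem_ball_self hr2)))).hasFDerivAt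
  · filter_upwards [hmem] with x hx
    exact h.tendsto_at (hsub hx (Metric.mem_ball_self hr2))

/-- Limits of holomorphic maps, in the compact-open topology, are holomorphic. -/
theorem isClosed_setOf_mdifferentiable {E F X Y : Type*} [NormedAddCommGroup E] [NormedSpace ℂ E]
    [FiniteDimensional ℂ E] [NormedAddCommGroup F] [NormedSpace ℂ F] [CompleteSpace F]
    [TopologicalSpace X] [LocallyCompactSpace X] [ChartedSpace E X] [IsManifold 𝓘(ℂ, E) 1 X]
    [TopologicalSpace Y] [ChartedSpace F Y] [IsManifold 𝓘(ℂ, F) 1 Y] :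
    IsClosed {g : C(X, Y) | MDifferentiable 𝓘(ℂ, E) 𝓘(ℂ, F) g} := by
  have : ProperSpace E := FiniteDimensional.proper ℂ E
  refine isClosed_of_closure_subset fun g hg x ↦ ?_
  let e := chartAt E x
  let e' := chartAt F (g x)
  have hxe : x ∈ e.source := mem_chart_source E x
  -- a closed coordinate ball around `x` that `g` maps into the domain of the chart at `g x`
  have hnhds : e.target ∩ e.symm ⁻¹' (g ⁻¹' e'.source) ∈ 𝓝 (e x) := by
    refine (e.isOpen_inter_preimage_symm (e'.open_source.preimage g.continuous)).mem_nhds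
      ⟨e.map_source hxe, ?_⟩
    rw [Set.mem_preimage, e.left_inv hxe]
    exact mem_chart_source F (g x)
  obtain ⟨r, hr, hball⟩ := Metric.nhds_basis_closedBall.mem_iff.1 hnhds
  have hsymm : ContinuousOn e.symm (Metric.closedBall (e x) r) :=
    e.continuousOn_symm.mono fun u hu ↦ (hball hu).1
  have hK : IsCompact (e.symm '' Metric.closedBall (e x) r) :=
    (isCompact_closedBall _ _).image_of_continuousOn hsymm
  let s : Set C(X, Y) := {h | Set.MapsTo h (e.symm '' Metric.closedBall (e x) r) e'.source}
  have hgs : g ∈ s := by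
    rintro _ ⟨u, hu, rfl⟩
    exact (hball hu).2
  let G : C(X, Y) → E → F := fun h u ↦ e' (h (e.symm u))
  have hcont : ContinuousOn (Function.uncurry G) (s ×ˢ Metric.closedBall (e x) r) := by
    refine e'.continuousOn.comp (s := s ×ˢ Metric.closedBall (e x) r)
      (f := fun p : C(X, Y) × E ↦ p.1 (e.symm p.2)) ?_ fun p hp ↦ hp.1 ⟨p.2, hp.2, rfl⟩
    have h2 : ContinuousOn (fun p : C(X, Y) × E ↦ e.symm p.2)
        (s ×ˢ Metric.closedBall (e x) r) := hsymm.comp continuousOn_snd fun p hp ↦ hp.2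
    exact (continuous_eval (F := C(X, Y))).comp_continuousOn (continuousOn_fst.prodMk h2)
  have hs : s ∈ 𝓝 g := ContinuousMap.eventually_mapsTo hK e'.open_source hgs
  let l : Filter C(X, Y) := 𝓝[{h | MDifferentiable 𝓘(ℂ, E) 𝓘(ℂ, F) h}] g
  have : l.NeBot := mem_closure_iff_nhdsWithin_neBot.1 hg
  have hunif : TendstoUniformlyOn G (G g) l (Metric.ball (e x) r) := by
    intro u hu
    obtain ⟨v, hv, hvu⟩ := (isCompact_closedBall (e x) r).mem_uniformity_of_prod hcont hgs
      (symm_le_uniformity hu)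
    rw [nhdsWithin_eq_nhds.2 hs] at hv
    filter_upwards [nhdsWithin_le_nhds hv] with h hh y hy
    exact hvu h hh y (Metric.ball_subset_closedBall hy)
  have hdiff : ∀ᶠ h in l, DifferentiableOn ℂ (G h) (Metric.ball (e x) r) := by
    filter_upwards [self_mem_nhdsWithin, nhdsWithin_le_nhds hs] with h hh hhs u hu
    have hu' := Metric.ball_subset_closedBall hu
    have h1 : MDifferentiableAt 𝓘(ℂ, E) 𝓘(ℂ, E) e.symm u :=
      mdifferentiableAt_atlas_symm (chart_mem_atlas E x) (hball hu').1
    have h2 : MDifferentiableAt 𝓘(ℂ, F) 𝓘(ℂ, F) e' (h (e.symm u)) :=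
      mdifferentiableAt_atlas (chart_mem_atlas F (g x)) (hhs ⟨u, hu', rfl⟩)
    have h3 : MDifferentiableAt 𝓘(ℂ, E) 𝓘(ℂ, F) (G h) u :=
      h2.comp u ((hh (e.symm u)).comp u h1)
    exact h3.differentiableAt.differentiableWithinAt
  have hG : DifferentiableAt ℂ (G g) (e x) :=
    differentiableAt_of_tendstoUniformlyOn_ball hr hdiff hunif
  have heq : (e'.symm ∘ G g ∘ e) =ᶠ[𝓝 x] g := by
    filter_upwards [e.open_source.mem_nhds hxe,
      g.continuous.continuousAt.preimage_mem_nhds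
        (e'.open_source.mem_nhds (mem_chart_source F (g x)))] with y hy hy'
    simp only [Function.comp_apply, G, e.left_inv hy]
    exact e'.left_inv hy'
  have h1 : MDifferentiableAt 𝓘(ℂ, E) 𝓘(ℂ, E) e x :=
    mdifferentiableAt_atlas (chart_mem_atlas E x) hxe
  have h2 : MDifferentiableAt 𝓘(ℂ, F) 𝓘(ℂ, F) e'.symm (G g (e x)) := by
    refine mdifferentiableAt_atlas_symm (chart_mem_atlas F (g x)) (e'.map_source ?_)
    rw [e.left_inv hxe]
    exact mem_chart_source F (g x)
  exact (h2.comp x (hG.mdifferentiableAt.comp x h1)).congr_of_eventuallyEq heq.symm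

/-! ### Iteration on taut manifolds -/

section Taut

variable {E : Type*} [NormedAddCommGroup E] [NormedSpace ℂ E]
  {X : Type*} [TopologicalSpace X] [T2Space X] [LocallyCompactSpace X]
  [ChartedSpace E X] [IsManifold 𝓘(ℂ, E) ω X]

instance : LocallyCompactSpace unitDisk := unitDisk.isOpen.locallyCompactSpace

/-- Holomorphic disks in a hyperbolic manifold form a family that is relatively compact in
`C(Δ, X*)`. -/
theorem isCompact_closure_disks (hX : IsKobayashiHyperbolic E X) {ι : Type*}
    (ψ : ι → Hol ℂ E unitDisk X) :
    IsCompact (closure (Set.range fun i ↦ (toOnePoint X).comp (ψ i).1)) := by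
  let _ : EMetricSpace X := kobayashiEMetric hX
  refine isCompact_closure_range_toOnePoint_comp (ψ := fun i ↦ (ψ i).1) fun ζ ↦ ?_
  refine uniformity_basis_edist.equicontinuousAt_iff_right.2 fun ε hε ↦ ?_
  have h : Tendsto (fun η ↦ ENNReal.ofReal (poincareDist ζ η)) (𝓝 ζ) (𝓝 0) := by
    simpa [poincareDist_self] using
      ENNReal.tendsto_ofReal ((continuous_poincareDist_right ζ).tendsto ζ)
  filter_upwards [h.eventually_lt_const hε] with η hη i
  exact (kobayashiDist_disk_le (ψ i) ζ η).trans_lt hη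

/-- If a family of disks in a taut manifold stays in a compact set at one point of `Δ`, then no limit
of the family is the constant map `∞`, so the family stays in a compact set at every point. -/
theorem exists_isCompact_disks_apply (hX : IsTaut E X) {ι : Type*}
    (ψ : ι → Hol ℂ E unitDisk X) {ζ : unitDisk} {K : Set X} (hK : IsCompact K)
    (hζ : ∀ i, (ψ i).1 ζ ∈ K) (η : unitDisk) :
    ∃ K', IsCompact K' ∧ ∀ i, (ψ i).1 η ∈ K' := by
  set S := Set.range fun i ↦ (toOnePoint X).comp (ψ i).1
  have hSc : IsCompact (closure S) := isCompact_closure_disks hX.1 ψ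
  have hSζ : closure S ⊆ {g | g ζ ∈ ((↑) : X → OnePoint X) '' K} := by
    refine closure_minimal ?_ ((hK.image OnePoint.continuous_coe).isClosed.preimage
      (continuous_eval_const ζ))
    rintro _ ⟨i, rfl⟩
    exact ⟨_, hζ i, rfl⟩
  have hSη : (fun g : C(unitDisk, OnePoint X) ↦ g η) '' closure S ⊆
      Set.range ((↑) : X → OnePoint X) := by
    rintro _ ⟨g, hg, rfl⟩
    have hg' : g ∈ closure (holDisks E X) := by
      refine closure_mono ?_ hg
      rintro _ ⟨i, rfl⟩
      exact ⟨ψ i, rfl⟩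
    rcases hX.2 g hg' with ⟨φ, rfl⟩ | rfl
    · exact ⟨φ.1 η, rfl⟩
    · obtain ⟨x, -, hx⟩ := hSζ hg
      exact absurd hx (OnePoint.coe_ne_infty x)
  refine ⟨_, OnePoint.isOpenEmbedding_coe.isInducing.isCompact_preimage'
    (hSc.image (continuous_eval_const η)) hSη, fun i ↦ ?_⟩
  exact ⟨_, subset_closure ⟨i, rfl⟩, rfl⟩

/-- On a connected taut manifold, a family of holomorphic self-maps that stays in a compact set at
one point stays in a compact set at every point: this property is passed on along disks. -/
theorem exists_isCompact_forall_apply_mem [ConnectedSpace X] (hX : IsTaut E X) {ι : Type*}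
    (F : ι → Hol E E X X) {z₀ : X} (h₀ : ∃ K, IsCompact K ∧ ∀ i, (F i).1 z₀ ∈ K) (z : X) :
    ∃ K, IsCompact K ∧ ∀ i, (F i).1 z ∈ K := by
  let S : Set X := {z | ∃ K, IsCompact K ∧ ∀ i, (F i).1 z ∈ K}
  have hlocal (z : X) : ∀ᶠ w in 𝓝 z, (z ∈ S ↔ w ∈ S) := by
    obtain ⟨c, -, h⟩ := exists_disk_near (E := E) z
    filter_upwards [h] with w ⟨φ, ζ, η, h1, h2, _⟩
    rw [← h1, ← h2]
    exact ⟨fun ⟨K, hK, h⟩ ↦ exists_isCompact_disks_apply hX (fun i ↦ (F i).comp φ) hK h η,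
      fun ⟨K, hK, h⟩ ↦ exists_isCompact_disks_apply hX (fun i ↦ (F i).comp φ) hK h ζ⟩
  have hopen : IsOpen S := isOpen_iff_eventually.2 fun z hz ↦ (hlocal z).mono fun w h ↦ h.1 hz
  have hclosed : IsClosed S := isOpen_compl_iff.1 <|
    isOpen_iff_eventually.2 fun z hz ↦ (hlocal z).mono fun w h hw ↦ hz (h.2 hw)
  exact (IsClopen.eq_univ ⟨hclosed, hopen⟩ ⟨z₀, h₀⟩).ge (Set.mem_univ z)

theorem lipschitzWith_kobayashi (hX : IsKobayashiHyperbolic E X) (f : Hol E E X X) :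
    letI := kobayashiEMetric hX
    LipschitzWith 1 f.1 := by
  intro x y
  rw [ENNReal.coe_one, one_mul]
  exact kobayashiDist_map_le f x y

/-- A family of holomorphic self-maps of a hyperbolic manifold with relatively compact orbits is
relatively compact, by Arzelà–Ascoli. -/
theorem isCompact_closure_range_hol [FiniteDimensional ℂ E] (hX : IsKobayashiHyperbolic E X)
    {ι : Type*} (F : ι → Hol E E X X) (h : ∀ z, ∃ K, IsCompact K ∧ ∀ i, (F i).1 z ∈ K) :
    IsCompact (closure (Set.range F)) := by
  have : CompleteSpace E := FiniteDimensional.complete ℂ E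
  have : IsManifold 𝓘(ℂ, E) 1 X := IsManifold.of_le (n := ω) (by simp)
  have hemb : Topology.IsClosedEmbedding (Subtype.val : Hol E E X X → C(X, X)) :=
    isClosed_setOf_mdifferentiable.isClosedEmbedding_subtypeVal
  have hc : IsCompact (closure (Set.range fun i ↦ (F i).1)) := by
    let _ : EMetricSpace X := kobayashiEMetric hX
    refine ContinuousMap.isCompact_closure_of_equicontinuous (fun x ↦ ?_) fun x ↦ ?_
    · refine uniformity_basis_edist.equicontinuousAt_iff_right.2 fun ε hε ↦ ?_
      filter_upwards [(tendsto_kobayashiDist_nhds (E := E) x).eventually_lt_const hε] with y hy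
      rintro ⟨_, i, rfl⟩
      exact (kobayashiDist_map_le (F i) x y).trans_lt hy
    · obtain ⟨K, hK, hF⟩ := h x
      refine ⟨K, hK, ?_⟩
      rintro _ ⟨i, rfl⟩
      exact hF i
  refine (hemb.isCompact_preimage hc).of_isClosed_subset isClosed_closure
    (closure_minimal ?_ (isClosed_closure.preimage hemb.continuous))
  rintro _ ⟨i, rfl⟩
  exact subset_closure (Set.mem_range_self i)

end Taut

theorem isCompact_closure_range_iff {X ι : Type*} [TopologicalSpace X] [T2Space X] (u : ι → X) :
    IsCompact (closure (Set.range u)) ↔ ∃ K, IsCompact K ∧ ∀ i, u i ∈ K := by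
  rw [← exists_isCompact_superset_iff]
  simp only [Set.range_subset_iff]

theorem mainTheorem2
    {E : Type*} [NormedAddCommGroup E] [NormedSpace ℂ E] [FiniteDimensional ℂ E]
    {X : Type*} [TopologicalSpace X] [T2Space X] [SecondCountableTopology X] [ConnectedSpace X]
    [ChartedSpace E X] [IsManifold 𝓘(ℂ, E) ω X]
    (hX : IsTaut E X) (f : Hol E E X X) :
    List.TFAE [
      ¬ CompactlyDivergent (fun k => (holIterate f k).1),
      ∀ n : ℕ → ℕ, StrictMono n → ¬ CompactlyDivergent (fun ν => (holIterate f (n ν)).1),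
      IsCompact (closure (Set.range (fun k => holIterate f k))),
      ∀ z : X, IsCompact (closure (Set.range (fun k => (holIterate f k).1 z))),
      ∃ z₀ : X, IsCompact (closure (Set.range (fun k => (holIterate f k).1 z₀)))] := by
  have : ProperSpace E := FiniteDimensional.proper ℂ E
  have : LocallyCompactSpace X := ChartedSpace.locallyCompactSpace E X
  simp only [isCompact_closure_range_iff]
  tfae_have 1 → 5 := by
    intro h
    let _ : EMetricSpace X := kobayashiEMetric hX.1
    simp only [CompactlyDivergent] at h
    push Not at h
    obtain ⟨H, K, hH, hK, h⟩ := h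
    exact (lipschitzWith_kobayashi hX.1 f).exists_isCompact_orbit_of_frequently hH hK
      (frequently_atTop.2 h)
  tfae_have 5 → 4 := fun ⟨z₀, h⟩ z ↦ exists_isCompact_forall_apply_mem hX (holIterate f) h z
  tfae_have 4 → 3 := fun h ↦
    (isCompact_closure_range_iff _).1 (isCompact_closure_range_hol hX.1 (holIterate f) h)
  tfae_have 3 → 4 := by
    rintro ⟨K, hK, h⟩ z
    refine ⟨_, hK.image ((continuous_eval_const z).comp continuous_subtype_val),
      fun k ↦ ⟨_, h k, rfl⟩⟩
  tfae_have 4 → 2 := by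
    intro h n _ hdiv
    obtain ⟨z⟩ := (inferInstance : Nonempty X)
    obtain ⟨K, hK, hz⟩ := h z
    obtain ⟨ν, hν⟩ := hdiv {z} K isCompact_singleton hK
    exact (hν ν le_rfl).le ⟨⟨z, rfl, rfl⟩, hz (n ν)⟩
  tfae_have 2 → 1 := fun h ↦ h id strictMono_id
  tfae_finish
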